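/- Let $X$ be a complex Banach space, let $T$ be a bounded linear operator on $X$, let $x\in X$ and $\alpha\ge 0$. Assume: (i) $T$ has the single-valued extension property (SVEP): for every open $U\subseteq\mathbb C$, the only analytic function $u:U\to X$ with $(zI-T)u(z)=0$ for all $z\in U$ is $u\equiv 0$; (ii) there is a constant $C>0$ with $\|e^{tT}x\|\le C(1+|t|)^{\alpha}$ for all $t\in\mathbb R$; (iii) $\sigma_T(x)=\{0\}$, where the local spectrum $\sigma_T(x)$ is the complement in $\mathbb C$ of the set of those $\lambda$ that have an open neighborhood $U$ on which some analytic function $u:U\to X$ satisfies $(zI-T)u(z)=x$ for all $z\in U$. Let $k=[\alpha]$ be the integer part of $\alpha$ and put $\omega(t)=(1+|t|)^{\alpha}$. Then for every $f$ in the Beurling algebra $L^1_\omega(\mathbb R)=\{f\in L^1(\mathbb R):\int_{\mathbb R}|f(t)|\,\omega(t)\,dt<\infty\}$ (complex-valued functions), the integral $x_f:=\int_{\mathbb R}f(t)\,e^{tT}x\,dt$ converges absolutely, the Fourier transform $\widehat f(s)=\int_{\mathbb R}f(t)e^{-ist}\,dt$ is $k$ times continuously differentiable on $\mathbb R$, and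 $$x_f=\sum_{j=0}^{k}\frac{\widehat f^{(j)}(0)}{j!}\,(iT)^jx .$$ In particular, $T^{k+1}x=0$. -/

import Mathlib

open MeasureTheory

noncomputable section

/-- The single-valued extension property: on every open `U ⊆ ℂ` the only analytic solution of
`(zI - T) u(z) = 0` is `u ≡ 0`. -/
def HasSVEP {X : Type*} [NormedAddCommGroup X] [NormedSpace ℂ X] (T : X →L[ℂ] X) : Prop :=
  ∀ U : Set ℂ, IsOpen U → ∀ u : ℂ → X, AnalyticOnNhd ℂ u U →
    (∀ z ∈ U, (z • (1 : X →L[ℂ] X) - T) (u z) = 0) → ∀ z ∈ U, u z = 0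

/-- The local resolvent set `ρ_T(x)`: the points near which `(zI - T) u(z) = x` has an analytic
solution. -/
def localResolventSet {X : Type*} [NormedAddCommGroup X] [NormedSpace ℂ X]
    (T : X →L[ℂ] X) (x : X) : Set ℂ :=
  {z₀ | ∃ U : Set ℂ, IsOpen U ∧ z₀ ∈ U ∧ ∃ u : ℂ → X, AnalyticOnNhd ℂ u U ∧
    ∀ z ∈ U, (z • (1 : X →L[ℂ] X) - T) (u z) = x}

/-- The local spectrum `σ_T(x)`. -/
def localSpectrum {X : Type*} [NormedAddCommGroup X] [NormedSpace ℂ X]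
    (T : X →L[ℂ] X) (x : X) : Set ℂ :=
  (localResolventSet T x)ᶜ

/-- The orbit `t ↦ e^{tT} x`, for real `t`. -/
def expOrbit {X : Type*} [NormedAddCommGroup X] [NormedSpace ℂ X]
    (T : X →L[ℂ] X) (x : X) (t : ℝ) : X :=
  NormedSpace.exp ((t : ℂ) • T) x

/-- The polynomial weight `ω(t) = (1 + |t|)^α`. -/
def polyWeight (α t : ℝ) : ℝ := (1 + |t|) ^ α

/-- Membership of (a representative) `f` in the Beurling algebra `L¹_ω(ℝ)`. -/
def MemBeurling (ω : ℝ → ℝ) (f : ℝ → ℂ) : Prop :=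
  Integrable f volume ∧ Integrable (fun t => ‖f t‖ * ω t) volume

/-- The Fourier transform with the normalization `f̂(s) = ∫ f(t) e^{-ist} dt`. -/
def fourierHat (f : ℝ → ℂ) (s : ℝ) : ℂ :=
  ∫ t : ℝ, f t * Complex.exp (-(Complex.I * (s : ℂ) * (t : ℂ)))

/-- The vector `x_f = ∫ f(t) e^{tT} x dt`. -/
def orbitIntegral {X : Type*} [NormedAddCommGroup X] [NormedSpace ℂ X]
    (T : X →L[ℂ] X) (x : X) (f : ℝ → ℂ) : X :=
  ∫ t : ℝ, f t • expOrbit T x t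

end

/-! The orbit map `F z = exp (z • T) x` is in fact a polynomial. Since the local spectrum is at most
`{0}`, the local resolvent, read in the variable `w = 1/z`, is entire with Taylor coefficients `(T ^
n) x`; Cauchy's estimates on large circles give `‖(T ^ n) x‖ ≤ M * ε ^ n` for every `ε > 0`, so `F`
has exponential type zero. Phragmén–Lindelöf then spreads the growth bound from the real axis to the
plane, and Liouville kills every derivative of `F` at `0` of order above `α`: `(T ^ (⌊α⌋₊ + 1)) x =
0`. Integrating the finite exponential sum against `f` produces moments of `f`, which are the
derivatives of its Fourier transform at `0`. -/

open Filter Topology Complex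

/-! ### Local resolvent and local spectral radius. -/

section LocalResolvent

variable {X : Type*} [NormedAddCommGroup X] [NormedSpace ℂ X]

/-- Under SVEP the local solutions of `(z - T) u(z) = x` glue to a solution on the whole local
resolvent set. -/
theorem HasSVEP.exists_local_resolvent {T : X →L[ℂ] X} (hT : HasSVEP T) (x : X) :
    ∃ u : ℂ → X, AnalyticOnNhd ℂ u (localResolventSet T x) ∧
      ∀ z ∈ localResolventSet T x, (z • (1 : X →L[ℂ] X) - T) (u z) = x := by
  classical
  have key : ∀ z : ℂ, ∃ U : Set ℂ, ∃ u : ℂ → X, z ∈ localResolventSet T x →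
      IsOpen U ∧ z ∈ U ∧ AnalyticOnNhd ℂ u U ∧
        ∀ w ∈ U, (w • (1 : X →L[ℂ] X) - T) (u w) = x := by
    intro z
    by_cases hz : z ∈ localResolventSet T x
    · obtain ⟨U, hU, hzU, u, hu, h⟩ := hz
      exact ⟨U, u, fun _ => ⟨hU, hzU, hu, h⟩⟩
    · exact ⟨∅, 0, fun h => absurd h hz⟩
  choose U u h using key
  refine ⟨fun z => u z z, fun z hz => ?_, fun z hz => (h z hz).2.2.2 z (h z hz).2.1⟩
  obtain ⟨hU, hzU, hu, hs⟩ := h z hz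
  refine (hu z hzU).congr ?_
  filter_upwards [hU.mem_nhds hzU] with w hw
  have hwr : w ∈ localResolventSet T x := ⟨U z, hU, hw, u z, hu, hs⟩
  obtain ⟨hU', hwU', hu', hs'⟩ := h w hwr
  -- SVEP makes two local solutions agree on the overlap of their domains.
  have := hT (U z ∩ U w) (hU.inter hU') (fun y => u z y - u w y)
    (fun y hy => (hu y hy.1).sub (hu' y hy.2))
    (fun y hy => by rw [map_sub, hs y hy.1, hs' y hy.2, sub_self]) w ⟨hw, hwU'⟩
  exact sub_eq_zero.1 this

/-- If the local spectrum of `x` is contained in `{0}`, then `(1 - wT) v(w) = x` has an entire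
solution. -/
theorem HasSVEP.exists_entire_solution [CompleteSpace X] {T : X →L[ℂ] X} (hT : HasSVEP T) {x : X}
    (hσ : localSpectrum T x ⊆ {0}) :
    ∃ v : ℂ → X, Differentiable ℂ v ∧ ∀ w, v w = x + w • T (v w) := by
  classical
  obtain ⟨u, hu, hs⟩ := hT.exists_local_resolvent x
  have hmem : ∀ z : ℂ, z ≠ 0 → z ∈ localResolventSet T x := fun z hz => by
    by_contra hn
    exact hz (hσ hn)
  set v : ℂ → X := fun w => if w = 0 then x else w⁻¹ • u w⁻¹ with hv
  have hsol : ∀ w, v w = x + w • T (v w) := by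
    intro w
    by_cases hw : w = 0
    · simp [hv, hw]
    · have h1 := hs w⁻¹ (hmem _ (inv_ne_zero hw))
      simp only [sub_apply, smul_apply, one_apply_eq_self] at h1
      simp only [hv, hw, if_false, map_smul, smul_smul, mul_inv_cancel₀ hw, one_smul]
      rw [← h1]
      abel
  refine ⟨v, fun w => ?_, hsol⟩
  by_cases hw : w = 0
  · subst hw
    -- Near `w = 0` (that is, `z = ∞`) the operator `1 - w • T` is invertible, so `v` must coincide
    -- with its analytic inverse applied to `x`.
    have hd : DifferentiableAt ℂ (fun w : ℂ => Ring.inverse (1 - w • T) x) 0 := by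
      have h1 : DifferentiableAt ℂ (fun w : ℂ => Ring.inverse (1 - w • T)) 0 := by
        have h2 : DifferentiableAt ℂ (Ring.inverse : (X →L[ℂ] X) → _) (1 - (0 : ℂ) • T) := by
          simpa using differentiableAt_inverse (𝕜 := ℂ) (R := X →L[ℂ] X) isUnit_one
        exact h2.comp (0 : ℂ) (f := fun w : ℂ => 1 - w • T) (by fun_prop)
      exact h1.clm_apply (differentiableAt_const x)
    refine hd.congr_of_eventuallyEq ?_
    have hunit : ∀ᶠ w : ℂ in 𝓝 0, IsUnit (1 - w • T) := by
      have hc : ContinuousAt (fun w : ℂ => 1 - w • T) 0 := by fun_prop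
      refine hc.eventually (Units.isOpen.mem_nhds ?_)
      simp
    filter_upwards [hunit] with w hw
    have h1 : (1 - w • T) (v w) = x := by
      simp only [sub_apply, smul_apply, one_apply_eq_self]
      exact sub_eq_of_eq_add (hsol w)
    rw [← h1, ← mul_apply_eq_comp, Ring.inverse_mul_cancel _ hw,
      one_apply_eq_self]
  · have hd : DifferentiableAt ℂ (fun w : ℂ => w⁻¹ • u w⁻¹) w := by
      have h1 : DifferentiableAt ℂ (fun w : ℂ => w⁻¹) w := differentiableAt_inv hw
      have h2 : DifferentiableAt ℂ u w⁻¹ :=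
        (hu _ (hmem _ (inv_ne_zero hw))).differentiableAt
      exact h1.smul (h2.comp w h1)
    refine hd.congr_of_eventuallyEq ?_
    filter_upwards [isOpen_ne.mem_nhds hw] with y hy
    simp only [hv, if_neg hy]

/-- Differentiating the functional equation repeatedly leaves only two Leibniz terms, because `w` is
linear; at `w = 0` one survives and gives a recursion. -/
theorem iteratedDeriv_zero_of_eq_add_smul [CompleteSpace X] {T : X →L[ℂ] X} {x : X} {v : ℂ → X}
    (hd : Differentiable ℂ v) (hv : ∀ w, v w = x + w • T (v w)) (n : ℕ) :
    iteratedDeriv n v 0 = (n.factorial : ℂ) • (T ^ n) x := by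
  have hD : ∀ n w, HasDerivAt (iteratedDeriv n v) (iteratedDeriv (n + 1) v w) w := fun n w => by
    rw [iteratedDeriv_succ]
    exact (hd.contDiff.differentiable_iteratedDeriv n (WithTop.coe_lt_top _) w).hasDerivAt
  have hrec : ∀ n w, iteratedDeriv (n + 1) v w =
      ((n + 1 : ℕ) : ℂ) • T (iteratedDeriv n v w) + w • T (iteratedDeriv (n + 1) v w) := by
    intro n
    induction n with
    | zero =>
      intro w
      have h2 := ((hasDerivAt_id w).smul (T.hasFDerivAt.comp_hasDerivAt w (hD 0 w))).const_add x
      have h3 : iteratedDeriv 0 v = fun w => x + w • T (v w) := by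
        rw [iteratedDeriv_zero]; exact funext hv
      have h1 := hD 0 w
      rw [h3] at h1
      have h4 := h1.unique (by simpa using! h2)
      refine h4.trans ?_
      simp [add_comm]
    | succ n ih =>
      intro w
      have h2 := ((T.hasFDerivAt.comp_hasDerivAt w (hD n w)).const_smul ((n + 1 : ℕ) : ℂ)).add
        ((hasDerivAt_id w).smul (T.hasFDerivAt.comp_hasDerivAt w (hD (n + 1) w)))
      have h1 := hD (n + 1) w
      have h4 := h1.unique (h2.congr_of_eventuallyEq (Eventually.of_forall fun w => ih w))
      conv_lhs => rw [h4]
      simp only [id, one_smul, Function.comp_apply]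
      push_cast
      module
  induction n with
  | zero => simpa using hv 0
  | succ n ih =>
    rw [hrec n 0, ih, zero_smul, add_zero, map_smul, smul_smul, ← Nat.cast_mul,
      ← Nat.factorial_succ, pow_succ', mul_apply_eq_comp]

/-- A vector whose local spectrum is contained in `{0}` has local spectral radius zero. -/
theorem HasSVEP.norm_pow_apply_le [CompleteSpace X] {T : X →L[ℂ] X} (hT : HasSVEP T) {x : X}
    (hσ : localSpectrum T x ⊆ {0}) {ε : ℝ} (hε : 0 < ε) :
    ∃ M : ℝ, ∀ n : ℕ, ‖(T ^ n) x‖ ≤ M * ε ^ n := by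
  obtain ⟨v, hd, hv⟩ := hT.exists_entire_solution hσ
  obtain ⟨M, hM⟩ := (isCompact_sphere (0 : ℂ) ε⁻¹).exists_bound_of_continuousOn
    hd.continuous.continuousOn
  refine ⟨M, fun n => ?_⟩
  have h := norm_iteratedDeriv_le_of_forall_mem_sphere_norm_le n (inv_pos.2 hε)
    hd.diffContOnCl hM
  rw [iteratedDeriv_zero_of_eq_add_smul hd hv, norm_smul, Complex.norm_natCast, mul_div_assoc] at h
  have h2 := le_of_mul_le_mul_left h (by exact_mod_cast n.factorial_pos)
  simpa [div_eq_mul_inv] using h2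

end LocalResolvent

/-! ### The entire orbit map. -/

section Exponential

variable {X : Type*} [NormedAddCommGroup X] [NormedSpace ℂ X] [CompleteSpace X]

theorem hasSum_exp_smul_apply (T : X →L[ℂ] X) (x : X) (z : ℂ) :
    HasSum (fun n : ℕ => ((n.factorial : ℂ)⁻¹ * z ^ n) • (T ^ n) x)
      (NormedSpace.exp (z • T) x) := by
  have h := (NormedSpace.exp_series_hasSum_exp' (𝕂 := ℂ) (z • T)).mapL
    (ContinuousLinearMap.apply ℂ X x)
  simpa [smul_pow, smul_smul] using! h

theorem norm_exp_smul_apply_le {T : X →L[ℂ] X} {x : X} {M ε : ℝ}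
    (h : ∀ n : ℕ, ‖(T ^ n) x‖ ≤ M * ε ^ n) (z : ℂ) :
    ‖NormedSpace.exp (z • T) x‖ ≤ M * Real.exp (ε * ‖z‖) := by
  have h1 : HasSum (fun n : ℕ => M * ((ε * ‖z‖) ^ n / n.factorial))
      (M * Real.exp (ε * ‖z‖)) := by
    rw [Real.exp_eq_exp_ℝ]
    exact (NormedSpace.expSeries_div_hasSum_exp (ε * ‖z‖)).mul_left M
  rw [← (hasSum_exp_smul_apply T x z).tsum_eq]
  refine tsum_of_norm_bounded h1 fun n => ?_
  rw [norm_smul, norm_mul, norm_inv, Complex.norm_natCast, norm_pow]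
  calc ((n.factorial : ℝ)⁻¹ * ‖z‖ ^ n) * ‖(T ^ n) x‖
      ≤ ((n.factorial : ℝ)⁻¹ * ‖z‖ ^ n) * (M * ε ^ n) := by gcongr; exact h n
    _ = M * ((ε * ‖z‖) ^ n / n.factorial) := by rw [mul_pow]; ring

theorem hasDerivAt_exp_smul_apply (T : X →L[ℂ] X) (x : X) (z : ℂ) :
    HasDerivAt (fun z : ℂ => NormedSpace.exp (z • T) x) (NormedSpace.exp (z • T) (T x)) z := by
  have := (hasDerivAt_exp_smul_const (𝕂 := ℂ) T z).clm_apply (hasDerivAt_const z x)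
  simpa using this

theorem iteratedDeriv_exp_smul_apply (T : X →L[ℂ] X) (x : X) (n : ℕ) :
    iteratedDeriv n (fun z : ℂ => NormedSpace.exp (z • T) x) =
      fun z => NormedSpace.exp (z • T) ((T ^ n) x) := by
  induction n with
  | zero => simp
  | succ n ih =>
    rw [iteratedDeriv_succ, ih]
    funext z
    rw [(hasDerivAt_exp_smul_apply T ((T ^ n) x) z).deriv, pow_succ',
      mul_apply_eq_comp]

end Exponential

/-! ### Phragmén–Lindelöf and Liouville. -/

section Growth

variable {E : Type*} [NormedAddCommGroup E] [NormedSpace ℂ E]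

/-- Phragmén–Lindelöf: an entire function of exponential type zero which grows polynomially on the
imaginary axis grows polynomially in the right half-plane. -/
theorem norm_le_of_exponential_type_zero_of_re_nonneg {G : ℂ → E} (hG : Differentiable ℂ G)
    {α C : ℝ} (hα : 0 ≤ α) (him : ∀ y : ℝ, ‖G (y * I)‖ ≤ C * (1 + |y|) ^ α)
    (hexp : ∀ ε : ℝ, 0 < ε → ∃ M : ℝ, ∀ z, ‖G z‖ ≤ M * Real.exp (ε * ‖z‖))
    {z : ℂ} (hz : 0 ≤ z.re) : ‖G z‖ ≤ C * 2 ^ α * ‖1 + z‖ ^ α := by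
  have hC : 0 ≤ C := by simpa using (norm_nonneg _).trans (him 0)
  have hone : ∀ w : ℂ, 0 ≤ w.re → 1 ≤ ‖1 + w‖ := fun w hw => by
    refine le_trans ?_ (Complex.re_le_norm _)
    simpa using hw
  have hnorm : ∀ (ε : ℝ) (w : ℂ), ‖exp (-ε * w) • ((1 + w) ^ ((-α : ℝ) : ℂ)) • G w‖ =
      Real.exp (-ε * w.re) * (‖1 + w‖ ^ (-α) * ‖G w‖) := fun ε w => by
    rw [norm_smul, norm_smul, Complex.norm_exp, Complex.norm_cpow_real]
    simp
  have hle : ∀ (ε : ℝ) (w : ℂ), 0 ≤ w.re →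
      ‖exp (-ε * w) • ((1 + w) ^ ((-α : ℝ) : ℂ)) • G w‖ ≤ Real.exp (-ε * w.re) * ‖G w‖ :=
    fun ε w hw => by
      rw [hnorm]
      have := Real.rpow_le_one_of_one_le_of_nonpos (hone w hw) (neg_nonpos.2 hα)
      gcongr
      exact mul_le_of_le_one_left (norm_nonneg _) this
  have main : ∀ ε : ℝ, 0 < ε →
      Real.exp (-ε * z.re) * (‖1 + z‖ ^ (-α) * ‖G z‖) ≤ C * 2 ^ α := by
    intro ε hε
    rw [← hnorm]
    obtain ⟨M, hM⟩ := hexp ε hε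
    -- `(1 + w) ^ (-α)` absorbs the growth on the imaginary axis, and `exp (-ε * w)` the exponential
    -- growth on the positive reals; `ε → 0` at the end.
    refine PhragmenLindelof.right_half_plane_of_bounded_on_real
      (f := fun w : ℂ => exp (-ε * w) • ((1 + w) ^ ((-α : ℝ) : ℂ)) • G w) ?_ ?_ ?_ ?_ hz
    · refine DifferentiableOn.diffContOnCl fun w hw => DifferentiableAt.differentiableWithinAt ?_
      rw [Complex.closure_setOfPred_lt_re] at hw
      have hs : 1 + w ∈ slitPlane := Or.inl (by
        have : 0 ≤ w.re := hw
        simp only [add_re, one_re]; linarith)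
      have h1 : DifferentiableAt ℂ (fun w : ℂ => (1 + w) ^ ((-α : ℝ) : ℂ)) w :=
        DifferentiableAt.cpow_const (by fun_prop) hs
      exact DifferentiableAt.smul (by fun_prop) (h1.smul (hG w))
    · refine ⟨1, one_lt_two, ε, Asymptotics.IsBigO.of_bound M ?_⟩
      refine eventually_inf_principal.2 (Eventually.of_forall fun w hw => ?_)
      have hw' : 0 ≤ w.re := le_of_lt hw
      rw [Real.norm_eq_abs, Real.abs_exp, Real.rpow_one]
      refine ((hle ε w hw').trans ?_).trans (hM w)
      refine mul_le_of_le_one_left (norm_nonneg _) (Real.exp_le_one_iff.2 ?_)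
      nlinarith
    · refine ⟨M, ?_⟩
      rw [eventually_map]
      filter_upwards [eventually_ge_atTop 0] with t ht
      refine (hle ε t (by simpa using ht)).trans ?_
      calc Real.exp (-ε * (t : ℂ).re) * ‖G t‖
          ≤ Real.exp (-ε * (t : ℂ).re) * (M * Real.exp (ε * ‖(t : ℂ)‖)) := by
            gcongr; exact hM t
        _ = M := by
            rw [Complex.norm_real, Real.norm_of_nonneg ht, ofReal_re, mul_left_comm,
              ← Real.exp_add]
            simp
    · intro y
      rw [hnorm]
      have hre : ((y : ℂ) * I).re = 0 := by simp
      have h1 : 0 < ‖1 + (y : ℂ) * I‖ := one_pos.trans_le (hone _ hre.ge)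
      have h2 : 1 + |y| ≤ 2 * ‖1 + (y : ℂ) * I‖ := by
        have h3 : |y| ≤ ‖1 + (y : ℂ) * I‖ := by
          simpa using Complex.abs_im_le_norm (1 + (y : ℂ) * I)
        linarith [hone _ hre.ge]
      rw [hre, mul_zero, Real.exp_zero, one_mul, Real.rpow_neg h1.le,
        inv_mul_le_iff₀ (Real.rpow_pos_of_pos h1 α)]
      calc ‖G (y * I)‖ ≤ C * (1 + |y|) ^ α := him y
        _ ≤ C * (2 * ‖1 + (y : ℂ) * I‖) ^ α := by gcongr
        _ = ‖1 + (y : ℂ) * I‖ ^ α * (C * 2 ^ α) := by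
          rw [Real.mul_rpow zero_le_two h1.le]; ring
  have h1 : 0 < ‖1 + z‖ := one_pos.trans_le (hone z hz)
  have hlim : Tendsto (fun ε : ℝ => Real.exp (-ε * z.re) * (‖1 + z‖ ^ (-α) * ‖G z‖)) (𝓝[>] 0)
      (𝓝 (‖1 + z‖ ^ (-α) * ‖G z‖)) :=
    (Continuous.tendsto' (by fun_prop) _ _ (by simp)).mono_left nhdsWithin_le_nhds
  have h2 := le_of_tendsto hlim (eventually_mem_nhdsWithin.mono main)
  rwa [Real.rpow_neg h1.le, inv_mul_le_iff₀ (Real.rpow_pos_of_pos h1 α), mul_comm] at h2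

/-- Rotation by `∓I` carries the right half-plane to the lower and upper half-planes, and the
imaginary axis to the real one. -/
theorem norm_le_of_exponential_type_zero {F : ℂ → E} (hF : Differentiable ℂ F)
    {α C : ℝ} (hα : 0 ≤ α) (hre : ∀ t : ℝ, ‖F t‖ ≤ C * (1 + |t|) ^ α)
    (hexp : ∀ ε : ℝ, 0 < ε → ∃ M : ℝ, ∀ z, ‖F z‖ ≤ M * Real.exp (ε * ‖z‖)) (z : ℂ) :
    ‖F z‖ ≤ C * 2 ^ α * (1 + ‖z‖) ^ α := by
  have hC : 0 ≤ C := by simpa using (norm_nonneg _).trans (hre 0)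
  have key : ∀ c : ℂ, ‖c‖ = 1 → (∃ s : ℝ, |s| = 1 ∧ c * I = s) → ∀ w : ℂ, 0 ≤ w.re →
      ‖F (c * w)‖ ≤ C * 2 ^ α * (1 + ‖w‖) ^ α := by
    rintro c hc ⟨s, hs, hcs⟩ w hw
    have h := norm_le_of_exponential_type_zero_of_re_nonneg (G := fun w => F (c * w)) (C := C)
      (hF.comp (by fun_prop)) hα (fun y => ?_) (fun ε hε => ?_) hw
    · refine h.trans ?_
      gcongr
      simpa using norm_add_le 1 w
    · have h1 : c * (y * I) = ((y * s : ℝ) : ℂ) := by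
        rw [mul_left_comm, hcs]; push_cast; ring
      have h2 := hre (y * s)
      rw [abs_mul, hs, mul_one] at h2
      rwa [h1]
    · obtain ⟨M, hM⟩ := hexp ε hε
      exact ⟨M, fun w => by simpa [hc] using hM (c * w)⟩
  rcases le_total 0 (I * z).re with h | h
  · have := key (-I) (by simp) ⟨1, by simp, by simp⟩ (I * z) h
    simpa [← mul_assoc] using this
  · have := key I (by simp) ⟨-1, by simp, by simp⟩ (-(I * z)) (by simpa using h)
    simpa [← mul_assoc] using this

/-- Liouville's theorem for functions of polynomial growth. -/
theorem iteratedDeriv_eq_zero_of_norm_le_rpow [CompleteSpace E] {F : ℂ → E}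
    (hF : Differentiable ℂ F) {α K : ℝ} (hα : 0 ≤ α)
    (hK : ∀ z, ‖F z‖ ≤ K * (1 + ‖z‖) ^ α) {n : ℕ} (hn : α < n) : iteratedDeriv n F 0 = 0 := by
  have hK0 : 0 ≤ K := by simpa using (norm_nonneg _).trans (hK 0)
  have hlim : Tendsto (fun R : ℝ => n.factorial * (K * 2 ^ α) * R ^ (-(n - α))) atTop (𝓝 0) := by
    simpa using (tendsto_rpow_neg_atTop (sub_pos.2 hn)).const_mul (n.factorial * (K * 2 ^ α))
  -- Cauchy's estimate on radius `R → ∞`; the factor `2 ^ α` comes from `1 + R ≤ 2 * R` for `R ≥ 1`.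
  refine norm_le_zero_iff.1 (ge_of_tendsto hlim ?_)
  filter_upwards [eventually_ge_atTop 1] with R hR
  have hR0 : 0 < R := one_pos.trans_le hR
  have h := norm_iteratedDeriv_le_of_forall_mem_sphere_norm_le (c := 0) n hR0
    hF.diffContOnCl (C := K * (2 * R) ^ α) fun z hz => by
      rw [mem_sphere_zero_iff_norm] at hz
      refine (hK z).trans ?_
      rw [hz]
      gcongr
      linarith
  refine h.trans_eq ?_
  rw [Real.mul_rpow zero_le_two hR0.le, neg_sub, Real.rpow_sub hR0, Real.rpow_natCast]
  ring

end Growth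

theorem pow_apply_eq_zero_of_polynomial_growth {X : Type*} [NormedAddCommGroup X]
    [NormedSpace ℂ X] [CompleteSpace X] {T : X →L[ℂ] X} (hT : HasSVEP T) {x : X}
    (hσ : localSpectrum T x ⊆ {0}) {α C : ℝ} (hα : 0 ≤ α)
    (hgrowth : ∀ t : ℝ, ‖expOrbit T x t‖ ≤ C * polyWeight α t) {n : ℕ} (hn : α < n) :
    (T ^ n) x = 0 := by
  have hF : Differentiable ℂ fun z : ℂ => NormedSpace.exp (z • T) x :=
    fun z => (hasDerivAt_exp_smul_apply T x z).differentiableAt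
  have hbound := norm_le_of_exponential_type_zero hF hα hgrowth fun ε hε =>
    (hT.norm_pow_apply_le hσ hε).imp fun M hM => norm_exp_smul_apply_le hM
  have h := iteratedDeriv_eq_zero_of_norm_le_rpow hF hα hbound hn
  rw [iteratedDeriv_exp_smul_apply] at h
  simpa using h

/-! ### Moments as derivatives of the Fourier transform. -/

section Fourier

theorem fourierHat_eq_fourier (f : ℝ → ℂ) :
    fourierHat f = fun s => FourierTransform.fourier f ((2 * Real.pi)⁻¹ * s) := by
  funext s
  rw [Real.fourier_eq', fourierHat]
  refine integral_congr_ae (Eventually.of_forall fun t => ?_)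
  simp only [smul_eq_mul, RCLike.inner_apply, conj_trivial]
  rw [mul_comm]
  congr 2
  push_cast
  have : (Real.pi : ℂ) ≠ 0 := by exact_mod_cast Real.pi_ne_zero
  field_simp

theorem contDiff_fourierHat {f : ℝ → ℂ} {k : ℕ}
    (hf : ∀ n ≤ k, Integrable fun t : ℝ => t ^ n • f t) : ContDiff ℝ k (fourierHat f) := by
  rw [fourierHat_eq_fourier]
  have h : ContDiff ℝ ((k : ℕ∞) : WithTop ℕ∞) (FourierTransform.fourier f) :=
    Real.contDiff_fourier fun n hn => by
      simpa [norm_smul] using (hf n (by exact_mod_cast hn)).norm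
  exact h.comp (contDiff_const.mul contDiff_id)

theorem iteratedDeriv_fourierHat_zero {f : ℝ → ℂ} {k : ℕ}
    (hf : ∀ n ≤ k, Integrable fun t : ℝ => t ^ n • f t) :
    iteratedDeriv k (fourierHat f) 0 = (-I) ^ k * ∫ t : ℝ, (t : ℂ) ^ k * f t := by
  have h : ContDiff ℝ ((k : ℕ∞) : WithTop ℕ∞) (FourierTransform.fourier f) :=
    Real.contDiff_fourier fun n hn => by
      simpa [norm_smul] using (hf n (by exact_mod_cast hn)).norm
  rw [fourierHat_eq_fourier, iteratedDeriv_comp_const_smul h,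
    Real.iteratedDeriv_fourier (N := k) (fun n hn => hf n (by exact_mod_cast hn)) le_rfl]
  simp only [mul_zero]
  rw [Real.fourier_eq']
  simp only [inner_zero_right, mul_zero, ofReal_zero, zero_mul, Complex.exp_zero,
    smul_eq_mul, mul_pow _ (_ : ℂ) k, mul_assoc]
  simp only [integral_const_mul, Complex.real_smul]
  have hpi : (Real.pi : ℂ) ≠ 0 := by exact_mod_cast Real.pi_ne_zero
  have hk : ((2 * Real.pi)⁻¹ : ℂ) ^ k * (-2) ^ k * (Real.pi : ℂ) ^ k * I ^ k = (-I) ^ k := by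
    simp only [← mul_pow]
    congr 1
    field_simp
  rw [← hk]
  push_cast
  ring

end Fourier

/-! ### Integrating the polynomial orbit against `f`. -/

theorem MemBeurling.integrable_pow_smul {α : ℝ} (hα : 0 ≤ α) {f : ℝ → ℂ}
    (hf : MemBeurling (polyWeight α) f) {n : ℕ} (hn : n ≤ ⌊α⌋₊) :
    Integrable fun t : ℝ => t ^ n • f t := by
  refine hf.2.mono (by have := hf.1.aestronglyMeasurable; fun_prop)
    (Eventually.of_forall fun t => ?_)
  have h1 : (1 : ℝ) ≤ 1 + |t| := by simp
  rw [norm_smul, norm_pow, Real.norm_eq_abs, mul_comm, polyWeight, norm_mul, norm_norm,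
    Real.norm_of_nonneg (by positivity)]
  gcongr
  calc |t| ^ n ≤ (1 + |t|) ^ n := by gcongr; linarith
    _ = (1 + |t|) ^ (n : ℝ) := (Real.rpow_natCast _ _).symm
    _ ≤ (1 + |t|) ^ α := Real.rpow_le_rpow_of_exponent_le h1 ((Nat.le_floor_iff hα).1 hn)

theorem expOrbit_eq_sum {X : Type*} [NormedAddCommGroup X] [NormedSpace ℂ X] [CompleteSpace X]
    {T : X →L[ℂ] X} {x : X} {m : ℕ} (h : (T ^ m) x = 0) (t : ℝ) :
    expOrbit T x t =
      ∑ j ∈ Finset.range m, ((j.factorial : ℂ)⁻¹ * (t : ℂ) ^ j) • (T ^ j) x := by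
  refine (hasSum_exp_smul_apply T x t).unique (hasSum_sum_of_ne_finset_zero fun n hn => ?_)
  obtain ⟨d, rfl⟩ := Nat.exists_eq_add_of_le' (not_lt.1 (mt Finset.mem_range.2 hn))
  rw [pow_add T, mul_apply_eq_comp, h, map_zero, smul_zero]

theorem proposition2p7 {X : Type*} [NormedAddCommGroup X] [NormedSpace ℂ X] [CompleteSpace X]
    (T : X →L[ℂ] X) (x : X) (α : ℝ) (hα : 0 ≤ α)
    (hT : HasSVEP T)
    (hgrowth : ∃ C : ℝ, 0 < C ∧ ∀ t : ℝ, ‖expOrbit T x t‖ ≤ C * polyWeight α t)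
    (hσ : localSpectrum T x = {0}) :
    (∀ f : ℝ → ℂ, MemBeurling (polyWeight α) f →
      Integrable (fun t : ℝ => f t • expOrbit T x t) volume ∧
      ContDiff ℝ (⌊α⌋₊ : ℕ) (fourierHat f) ∧
      orbitIntegral T x f =
        ∑ j ∈ Finset.range (⌊α⌋₊ + 1),
          (iteratedDeriv j (fourierHat f) 0 / (j.factorial : ℂ)) •
            ((Complex.I • T) ^ j) x) ∧
    (T ^ (⌊α⌋₊ + 1)) x = 0 := by
  obtain ⟨C, -, hC⟩ := hgrowth
  have hzero : (T ^ (⌊α⌋₊ + 1)) x = 0 :=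
    pow_apply_eq_zero_of_polynomial_growth hT hσ.subset hα hC
      (by exact_mod_cast Nat.lt_floor_add_one α)
  refine ⟨fun f hf => ?_, hzero⟩
  have hint : ∀ j ∈ Finset.range (⌊α⌋₊ + 1), Integrable fun t : ℝ => t ^ j • f t :=
    fun j hj => hf.integrable_pow_smul hα (Nat.lt_succ_iff.1 (Finset.mem_range.1 hj))
  have hexpand : (fun t : ℝ => f t • expOrbit T x t) = fun t : ℝ =>
      ∑ j ∈ Finset.range (⌊α⌋₊ + 1), (t ^ j • f t) • ((j.factorial : ℂ)⁻¹ • (T ^ j) x) := by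
    funext t
    rw [expOrbit_eq_sum hzero, Finset.smul_sum]
    refine Finset.sum_congr rfl fun j _ => ?_
    rw [smul_smul, smul_smul, Complex.real_smul]
    push_cast
    congr 1
    ring
  refine ⟨?_, contDiff_fourierHat fun n hn => hf.integrable_pow_smul hα hn, ?_⟩
  · rw [hexpand]
    exact integrable_finsetSum _ fun j hj => (hint j hj).smul_const _
  · rw [orbitIntegral, hexpand, integral_finsetSum _ fun j hj => (hint j hj).smul_const _]
    refine Finset.sum_congr rfl fun j hj => ?_
    rw [integral_smul_const, iteratedDeriv_fourierHat_zero fun n hn => hf.integrable_pow_smul hα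
      (hn.trans (Nat.lt_succ_iff.1 (Finset.mem_range.1 hj))), smul_pow, smul_apply, smul_smul,
      smul_smul]
    congr 1
    simp only [Complex.real_smul, ofReal_pow]
    -- The `(-I) ^ j` from differentiating the transform cancels the `I ^ j` of `(I • T) ^ j`.
    have : (-I) ^ j * I ^ j = 1 := by rw [← mul_pow]; simp
    linear_combination (-(∫ t : ℝ, (t : ℂ) ^ j * f t) * (j.factorial : ℂ)⁻¹) * this
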